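/- Let $n,T\in\mathbb{N}$, $T\ge 1$. Let $L_t:\mathbb{R}^n\times\mathbb{R}^n\to\mathbb{R}\cup\{+\infty\}$ ($t=1,\dots,T$) and $g:\mathbb{R}^n\to\mathbb{R}\cup\{+\infty\}$ be proper, convex and lower semicontinuous. Write $\Delta x_t=x_t-x_{t-1}$, and for $\tau\in\{0,\dots,T-1\}$ and $\xi\in\mathbb{R}^n$ let $$\vartheta_\tau(\xi)=\inf\Big\{\sum_{t=\tau+1}^{T}L_t(x_{t-1},\Delta x_t)+g(x_T)\ :\ x_\tau,\dots,x_T\in\mathbb{R}^n,\ x_\tau=\xi\Big\}.$$ For $\varphi:\mathbb{R}^n\to\mathbb{R}\cup\{\pm\infty\}$ let $\operatorname{dom}\varphi=\{x:\varphi(x)<+\infty\}$, let $\varphi^*(y)=\sup_x\{x\cdot y-\varphi(x)\}$, let $\partial\varphi(x)=\{y:\varphi(x)+y\cdot(z-x)\le\varphi(z)\ \forall z\in\mathbb{R}^n\}$ for $x\in\operatorname{dom}\varphi$, and $\partial\varphi(x)=\emptyset$ otherwise. The Hamiltonian is $H_t(x,p)=\sup_{v}\{p\cdot v-L_t(x,v)\}$,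 and its concave-convex subdifferential is $$\partial H_t(x,p)=\big[-\partial(-H_t(\cdot,p))(x)\big]\times\partial (H_t(x,\cdot))(p).$$ A discrete-time Hamiltonian trajectory on $\{\tau,\dots,T\}$ is a family $(x_t,p_t)_{t=\tau}^T$ in $\mathbb{R}^n\times\mathbb{R}^n$ such that $(-\Delta p_t,\Delta x_t)\in\partial H_t(x_{t-1},p_t)$ for all $t\in\{\tau+1,\dots,T\}$. Let $K_t(p,w)=\sup_{x,v}\{x\cdot w+v\cdot p-L_t(x,v)\}$ and $f(b)=g^*(-b)$. Put $\Gamma_L(t,x)=\{v: L_t(x,v)\in\mathbb{R}\}$, $X(t)=\{x:\Gamma_L(t,x)\ne\emptyset\}$, $\Gamma_K(t,p)=\{w: K_t(p+w,w)\in\mathbb{R}\}$, $P(t)=\{p:\Gamma_K(t,p)\neq\emptyset\}$, and let $\operatorname{ri}$ denote the relative interior. Consider the qualification conditions (H) there are $\bar x_0,\dots,\bar x_T\in\mathbb{R}^n$ with $\bar x_T\in\operatorname{ri}(\operatorname{dom} g)$, and $\bar x_{t-1}\in\operatorname{ri}X(t)$, $\Delta\bar x_t\in\operatorname{ri}\Gamma_L(t,\bar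 x_{t-1})$ for all $t\in\{1,\dots,T\}$; (H') there are $\bar p_0,\dots,\bar p_T\in\mathbb{R}^n$ with $\bar p_T\in\operatorname{ri}(\operatorname{dom} f)$, and $\bar p_{t-1}\in\operatorname{ri}P(t)$, $\Delta\bar p_t\in\operatorname{ri}\Gamma_K(t,\bar p_{t-1})$ for all $t\in\{1,\dots,T\}$. **Theorem (discrete-time characteristic method).** Let $\tau\in\{0,\dots,T-1\}$ and $\xi,\eta\in\mathbb{R}^n$. If there is a discrete-time Hamiltonian trajectory $(x_t,p_t)_{t=\tau}^T$ on $\{\tau,\dots,T\}$ with $(x_\tau,p_\tau)=(\xi,-\eta)$ that satisfies the transversality condition $-p_T\in\partial g(x_T)$, then $\eta\in\partial\vartheta_\tau(\xi)$. Conversely, if (H) and (H') hold and $\eta\in\partial\vartheta_\tau(\xi)$, then such a trajectory exists. -/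

import Mathlib

noncomputable section

namespace Bolza

/-- `ℝⁿ` with the Euclidean norm and inner product. -/
abbrev E (n : ℕ) : Type := EuclideanSpace ℝ (Fin n)

/-- The Euclidean inner product, as an extended real. -/
def dot {n : ℕ} (a b : E n) : EReal := ((inner ℝ a b : ℝ) : EReal)

/-- Effective domain. -/
def dom {X : Type*} (φ : X → EReal) : Set X := {x | φ x < ⊤}

/-- Epigraph, a subset of `X × ℝ`. -/
def epi {X : Type*} (φ : X → EReal) : Set (X × ℝ) := {q | φ q.1 ≤ (q.2 : EReal)}

/-- Proper: somewhere `< +∞`, and nowhere `-∞`. -/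
def IsProper {X : Type*} (φ : X → EReal) : Prop := (dom φ).Nonempty ∧ ∀ x, ⊥ < φ x

/-- Proper, convex (convex epigraph) and lower semicontinuous (closed epigraph). -/
structure IsProperConvexLsc {X : Type*} [AddCommGroup X] [Module ℝ X] [TopologicalSpace X]
    (φ : X → EReal) : Prop where
  proper : IsProper φ
  convex : Convex ℝ (epi φ)
  lsc : IsClosed (epi φ)

/-- The conjugate `φ*(y) = sup_x (x · y - φ x)`. -/
def conj {n : ℕ} (φ : E n → EReal) (y : E n) : EReal := ⨆ x : E n, (dot x y - φ x)

/-- The convex subdifferential; it is empty outside the effective domain. -/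
def subdiff {n : ℕ} (φ : E n → EReal) (x : E n) : Set (E n) :=
  {y | x ∈ dom φ ∧ ∀ z : E n, φ x + dot y (z - x) ≤ φ z}

/-- The concave-convex subdifferential `[-∂(-h(·, y))(x)] × ∂(h(x, ·))(y)`. -/
def saddleSubdiff {n : ℕ} (h : E n → E n → EReal) (x y : E n) : Set (E n × E n) :=
  {q | -q.1 ∈ subdiff (fun x' => -h x' y) x ∧ q.2 ∈ subdiff (fun y' => h x y') y}

/-- The backward difference `Δx_t = x_t - x_{t-1}`; it is used only for `t ≥ 1`. -/
def diff {n : ℕ} (x : ℕ → E n) (t : ℕ) : E n := x t - x (t - 1)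

/-- The standing assumption on the data: each `L_t`, `1 ≤ t ≤ T`, is proper, convex and l.s.c.
jointly in its two arguments, and so is `g`. -/
structure FullyConvex {n : ℕ} (T : ℕ) (L : ℕ → E n → E n → EReal) (g : E n → EReal) : Prop where
  lagrangian : ∀ t ∈ Finset.Icc 1 T,
    IsProperConvexLsc (fun q : E n × E n => L t q.1 q.2)
  terminal : IsProperConvexLsc g

/-- The cost `∑_{t=τ+1}^T L_t(x_{t-1}, Δx_t) + g(x_T)`; it only involves `x_τ, …, x_T`. -/
def cost {n : ℕ} (T : ℕ) (L : ℕ → E n → E n → EReal) (g : E n → EReal) (τ : ℕ)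
    (x : ℕ → E n) : EReal :=
  (∑ t ∈ Finset.Icc (τ + 1) T, L t (x (t - 1)) (diff x t)) + g (x T)

/-- The value function `ϑ_τ(ξ)`: infimum of the cost over arcs that start at `ξ` at time `τ`. -/
def value {n : ℕ} (T : ℕ) (L : ℕ → E n → E n → EReal) (g : E n → EReal) (τ : ℕ)
    (ξ : E n) : EReal :=
  ⨅ (x : ℕ → E n) (_ : x τ = ξ), cost T L g τ x

/-- The Hamiltonian `H_t(x, p) = sup_v (p · v - L_t(x, v))`. -/
def hamiltonian {n : ℕ} (L : ℕ → E n → E n → EReal) (t : ℕ) (x p : E n) : EReal :=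
  ⨆ v : E n, (dot p v - L t x v)

/-- The dual Lagrangian `K_t(p, w) = sup_{x, v} (x · w + v · p - L_t(x, v))`. -/
def dualLagrangian {n : ℕ} (L : ℕ → E n → E n → EReal) (t : ℕ) (p w : E n) : EReal :=
  ⨆ (x : E n) (v : E n), (dot x w + dot v p - L t x v)

/-- The dual terminal cost `f(b) = g*(-b)`. -/
def dualTerminal {n : ℕ} (g : E n → EReal) (b : E n) : EReal := conj g (-b)

/-- `Γ_L(t, x)`: the velocities at which `L_t(x, ·)` is a real number. -/
def primalDynamics {n : ℕ} (L : ℕ → E n → E n → EReal) (t : ℕ) (x : E n) : Set (E n) :=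
  {v | ∃ r : ℝ, L t x v = (r : EReal)}

/-- The state constraint set `{x | Γ_L(t, x) ≠ ∅}`. -/
def primalStates {n : ℕ} (L : ℕ → E n → E n → EReal) (t : ℕ) : Set (E n) :=
  {x | (primalDynamics L t x).Nonempty}

/-- `Γ_K(t, p)`: the `w` for which `K_t(p + w, w)` is a real number. -/
def dualDynamics {n : ℕ} (L : ℕ → E n → E n → EReal) (t : ℕ) (p : E n) : Set (E n) :=
  {w | ∃ r : ℝ, dualLagrangian L t (p + w) w = (r : EReal)}

/-- The dual state constraint set `{p | Γ_K(t, p) ≠ ∅}`. -/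
def dualStates {n : ℕ} (L : ℕ → E n → E n → EReal) (t : ℕ) : Set (E n) :=
  {p | (dualDynamics L t p).Nonempty}

/-- The primal qualification condition; `intrinsicInterior ℝ` is the relative interior. -/
def PrimalQualification {n : ℕ} (T : ℕ) (L : ℕ → E n → E n → EReal) (g : E n → EReal) : Prop :=
  ∃ x : ℕ → E n, x T ∈ intrinsicInterior ℝ (dom g) ∧
    ∀ t ∈ Finset.Icc 1 T, x (t - 1) ∈ intrinsicInterior ℝ (primalStates L t) ∧
      diff x t ∈ intrinsicInterior ℝ (primalDynamics L t (x (t - 1)))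

/-- The dual qualification condition. -/
def DualQualification {n : ℕ} (T : ℕ) (L : ℕ → E n → E n → EReal) (g : E n → EReal) : Prop :=
  ∃ p : ℕ → E n, p T ∈ intrinsicInterior ℝ (dom (dualTerminal g)) ∧
    ∀ t ∈ Finset.Icc 1 T, p (t - 1) ∈ intrinsicInterior ℝ (dualStates L t) ∧
      diff p t ∈ intrinsicInterior ℝ (dualDynamics L t (p (t - 1)))

/-- `(x_t, p_t)`, `τ ≤ t ≤ T`, is a discrete-time Hamiltonian trajectory:
`(-Δp_t, Δx_t) ∈ ∂H_t(x_{t-1}, p_t)` for `τ + 1 ≤ t ≤ T`. -/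
def IsHamiltonianTrajectory {n : ℕ} (T : ℕ) (L : ℕ → E n → E n → EReal) (τ : ℕ)
    (x p : ℕ → E n) : Prop :=
  ∀ t ∈ Finset.Icc (τ + 1) T,
    (-diff p t, diff x t) ∈ saddleSubdiff (hamiltonian L t) (x (t - 1)) (p t)

/-- There is a Hamiltonian trajectory on `[τ : T]` from `(ξ, -η)` that satisfies the
transversality condition `-p_T ∈ ∂g(x_T)`. -/
def HasCharacteristic {n : ℕ} (T : ℕ) (L : ℕ → E n → E n → EReal) (g : E n → EReal) (τ : ℕ)
    (ξ η : E n) : Prop :=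
  ∃ x p : ℕ → E n, IsHamiltonianTrajectory T L τ x p ∧ x τ = ξ ∧ p τ = -η ∧
    -p T ∈ subdiff g (x T)

end Bolza

end

/-! The arcs `p` carry a dual problem with stage costs `K_t(p_t, Δp_t) = K_t(p_{t-1} + Δp_t, Δp_t)`
and terminal cost `f`, which is again a problem of Bolza. Summation by parts and the Fenchel-Young
inequality at every stage give `cost x + dual cost p ≥ -⟨x_τ, p_τ⟩`, with equality exactly when
`(x, p)` is a Hamiltonian trajectory satisfying the transversality condition. Hence a characteristic
certifies an affine minorant of the value function that touches it at `ξ`.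

For the converse, treat states and velocities as independent variables and price the constraint
`v_t = Δx_t`. Under (H) a feasible arc lies in the relative core of the domain, so a Lagrange
multiplier `p` exists; it starts at `p_τ = -η` and attains the dual bound. The dual problem has (H')
as its qualification condition and, by Fenchel-Moreau, the original problem as its dual, so the same
argument produces an optimal `x`. Such a pair satisfies the equality above.
-/

namespace Bolza

open Set Topology Pointwise

/-- The algebraic relative interior (intrinsic core) of `C`: the points of `C` beyond which every
segment of `C` ending there can be prolonged. -/
def relCore {V : Type*} [AddCommGroup V] [Module ℝ V] (C : Set V) : Set V :=
  {x | x ∈ C ∧ ∀ y ∈ C, ∀ᶠ δ : ℝ in 𝓝[>] 0, x + δ • (x - y) ∈ C}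

section RelCore

variable {V W : Type*} [AddCommGroup V] [Module ℝ V] [AddCommGroup W] [Module ℝ W]

theorem exists_pos_of_mem_relCore {C : Set V} {x y : V} (hx : x ∈ relCore C) (hy : y ∈ C) :
    ∃ ε : ℝ, 0 < ε ∧ x + ε • (x - y) ∈ C :=
  (eventually_mem_nhdsWithin.and (hx.2 y hy)).exists

theorem mem_relCore_of_forall_exists_pos {C : Set V} (hC : Convex ℝ C) {x : V} (hx : x ∈ C)
    (h : ∀ y ∈ C, ∃ ε : ℝ, 0 < ε ∧ x + ε • (x - y) ∈ C) : x ∈ relCore C := by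
  refine ⟨hx, fun y hy => ?_⟩
  obtain ⟨ε, hε, hmem⟩ := h y hy
  filter_upwards [Ioo_mem_nhdsGT hε] with δ hδ
  have hseg : x + (δ / ε) • (ε • (x - y)) ∈ C :=
    hC.add_smul_mem hx hmem ⟨div_nonneg hδ.1.le hε.le, (div_le_one hε).2 hδ.2.le⟩
  rwa [smul_smul, div_mul_cancel₀ _ hε.ne'] at hseg

theorem intrinsicInterior_subset_relCore [TopologicalSpace V] [IsTopologicalAddGroup V]
    [ContinuousSMul ℝ V] (C : Set V) : intrinsicInterior ℝ C ⊆ relCore C := by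
  intro x hx
  refine ⟨intrinsicInterior_subset hx, fun y hy => ?_⟩
  obtain ⟨z, hz, rfl⟩ := mem_intrinsicInterior.1 hx
  have hline (δ : ℝ) : (z : V) + δ • ((z : V) - y) ∈ affineSpan ℝ C := by
    have h := AffineMap.lineMap_mem (-δ) z.2 (subset_affineSpan ℝ C hy)
    rw [AffineMap.lineMap_apply_module'] at h
    convert h using 1
    module
  let γ (δ : ℝ) : affineSpan ℝ C := ⟨(z : V) + δ • ((z : V) - y), hline δ⟩
  have hγ : Continuous γ := Continuous.subtype_mk (by fun_prop) hline
  have hγ₀ : γ 0 = z := Subtype.ext (by simp [γ])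
  have hnhds : interior ((↑) ⁻¹' C : Set (affineSpan ℝ C)) ∈ 𝓝 (γ 0) := by
    rw [hγ₀]
    exact isOpen_interior.mem_nhds hz
  exact nhdsWithin_le_nhds ((hγ.tendsto 0).eventually
    (Filter.Eventually.mono hnhds fun _ hw => interior_subset hw))

theorem map_mem_relCore_image {C : Set V} {x : V} (A : V →ₗ[ℝ] W) (hx : x ∈ relCore C) :
    A x ∈ relCore (A '' C) := by
  refine ⟨mem_image_of_mem A hx.1, forall_mem_image.2 fun y hy => ?_⟩
  filter_upwards [hx.2 y hy] with δ hδ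
  exact ⟨_, hδ, by simp⟩

theorem mem_relCore_preimage {C : Set W} {x : V} (A : V →ₗ[ℝ] W) (hx : A x ∈ relCore C) :
    x ∈ relCore (A ⁻¹' C) := by
  refine ⟨hx.1, fun y hy => ?_⟩
  filter_upwards [hx.2 (A y) hy] with δ hδ
  simpa using hδ

theorem mem_relCore_inter {C D : Set V} {x : V} (hC : x ∈ relCore C) (hD : x ∈ relCore D) :
    x ∈ relCore (C ∩ D) :=
  ⟨⟨hC.1, hD.1⟩, fun y hy => (hC.2 y hy.1).and (hD.2 y hy.2)⟩

theorem mem_relCore_biInter {ι : Type*} {s : Finset ι} {C : ι → Set V} {x : V}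
    (h : ∀ i ∈ s, x ∈ relCore (C i)) : x ∈ relCore (⋂ i ∈ s, C i) := by
  simp only [relCore, mem_iInter₂, mem_ofPred_eq, Finset.eventually_all]
  exact ⟨fun i hi => (h i hi).1, fun y hy i hi => (h i hi).2 y (hy i hi)⟩

theorem mk_mem_relCore {C : Set (V × W)} (hC : Convex ℝ C) {x : V} {v : W}
    (hx : x ∈ relCore (Prod.fst '' C)) (hv : v ∈ relCore (Prod.mk x ⁻¹' C)) :
    (x, v) ∈ relCore C := by
  refine mem_relCore_of_forall_exists_pos hC hv.1 ?_
  rintro ⟨y, w⟩ hyw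
  obtain ⟨ε, hε, ⟨x', w'⟩, hw', hfst⟩ := exists_pos_of_mem_relCore hx (mem_image_of_mem _ hyw)
  obtain rfl : x' = x + ε • (x - y) := hfst
  -- The segment from `(y, w)` to `(x', w')` meets the fibre over `x`; prolong from that point.
  have hfibre : (x, (1 / (1 + ε)) • w' + (ε / (1 + ε)) • w) ∈ C := by
    have h := hC hw' hyw (a := 1 / (1 + ε)) (b := ε / (1 + ε)) (by positivity) (by positivity)
      (by field_simp)
    convert h using 1
    refine Prod.ext ?_ rfl
    simp only [Prod.smul_mk, Prod.mk_add_mk]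
    match_scalars <;> field_simp
    ring
  obtain ⟨δ, hδ, hprolong⟩ := exists_pos_of_mem_relCore hv hfibre
  refine ⟨ε * δ / (1 + ε + δ), by positivity, ?_⟩
  have h := hC hprolong hw' (a := (1 + ε) / (1 + ε + δ)) (b := δ / (1 + ε + δ)) (by positivity)
    (by positivity) (by field_simp)
  convert h using 1
  simp only [Prod.smul_mk, Prod.mk_add_mk, Prod.mk_sub_mk]
  refine Prod.ext ?_ ?_ <;> match_scalars <;> field_simp <;> ring

theorem exists_eq_smul_of_mem_hull {S : Set V} (hS : Convex ℝ S) (hne : S.Nonempty) {x : V}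
    (hx : x ∈ PointedCone.hull ℝ S) : ∃ c : ℝ, 0 ≤ c ∧ ∃ y ∈ S, x = c • y := by
  induction hx using Submodule.span_induction with
  | mem y hy => exact ⟨1, zero_le_one, y, hy, (one_smul ℝ y).symm⟩
  | zero => exact ⟨0, le_rfl, hne.some, hne.some_mem, (zero_smul ℝ _).symm⟩
  | smul a _ _ ih =>
    obtain ⟨c, hc, y, hy, rfl⟩ := ih
    exact ⟨a * c, mul_nonneg a.2 hc, y, hy, (smul_smul (a : ℝ) c y)⟩
  | add _ _ _ _ ih₁ ih₂ =>
    obtain ⟨c, hc, y, hy, rfl⟩ := ih₁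
    obtain ⟨d, hd, z, hz, rfl⟩ := ih₂
    obtain ⟨w, hw, hsum⟩ : c • y + d • z ∈ (c + d) • S := by
      rw [hS.add_smul hc hd]
      exact Set.add_mem_add (smul_mem_smul_set hy) (smul_mem_smul_set hz)
    exact ⟨c + d, add_nonneg hc hd, w, hw, hsum.symm⟩

theorem exists_eq_smul_of_mem_span {D : Set V} (hD : Convex ℝ D) (h₀ : 0 ∈ relCore D) {x : V}
    (hx : x ∈ Submodule.span ℝ D) : ∃ c : ℝ, 0 ≤ c ∧ ∃ d ∈ D, x = c • d := by
  refine exists_eq_smul_of_mem_hull hD ⟨0, h₀.1⟩ ?_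
  induction hx using Submodule.span_induction with
  | mem y hy => exact Submodule.subset_span hy
  | zero => exact zero_mem _
  | add _ _ _ _ ih₁ ih₂ => exact add_mem ih₁ ih₂
  | smul a y _ ih =>
    obtain ha | ha := le_total 0 a
    · exact PointedCone.smul_mem _ ha ih
    obtain ⟨c, hc, d, hd, rfl⟩ := exists_eq_smul_of_mem_hull hD ⟨0, h₀.1⟩ ih
    obtain ⟨ε, hε, hneg⟩ := exists_pos_of_mem_relCore h₀ hd
    have hac : 0 ≤ -a * c / ε := div_nonneg (mul_nonneg (neg_nonneg.2 ha) hc) hε.le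
    convert PointedCone.smul_mem (PointedCone.hull ℝ D) hac (Submodule.subset_span hneg) using 1
    match_scalars
    field_simp

end RelCore

section LagrangeMultiplier

variable {U Z : Type*} [AddCommGroup U] [Module ℝ U] [AddCommGroup Z] [Module ℝ Z]

theorem exists_linear_minorant {G : Set (U × ℝ)} (hG : Convex ℝ G)
    (h₀ : 0 ∈ relCore (Prod.fst '' G)) (hfibre : ∀ r, ((0 : U), r) ∈ G → 0 ≤ r) :
    ∃ ℓ : U →ₗ[ℝ] ℝ, ∀ q ∈ G, ℓ q.1 ≤ q.2 := by
  have hD : Convex ℝ (Prod.fst '' G) := hG.linear_image (LinearMap.fst ℝ U ℝ)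
  have hne : G.Nonempty := image_nonempty.1 ⟨0, h₀.1⟩
  -- Riesz extension from `N × ℝ`: its density condition needs `N` to complement the span.
  obtain ⟨N, hN⟩ := Submodule.exists_isCompl (Submodule.span ℝ (Prod.fst '' G))
  let f : (U × ℝ) →ₗ.[ℝ] ℝ :=
    ⟨N.prod ⊤, (LinearMap.snd ℝ U ℝ).comp (N.prod ⊤).subtype⟩
  have nonneg (q : f.domain) (hq : (q : U × ℝ) ∈ PointedCone.hull ℝ G) : 0 ≤ f q := by
    obtain ⟨c, hc, d, hd, hqc⟩ := exists_eq_smul_of_mem_hull hG hne hq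
    change 0 ≤ (q : U × ℝ).2
    rw [hqc]
    obtain rfl | hc' := hc.eq_or_lt
    · simp
    have hdN : c • d.1 ∈ N := by simpa [hqc] using q.2.1
    have hd₀ : d.1 = 0 := Submodule.disjoint_def.1 hN.disjoint _
      (Submodule.subset_span (mem_image_of_mem _ hd)) ((N.smul_mem_iff hc'.ne').1 hdN)
    exact mul_nonneg hc (hfibre d.2 (hd₀ ▸ hd))
  have dense (y : U × ℝ) : ∃ q : f.domain, (q : U × ℝ) + y ∈ PointedCone.hull ℝ G := by
    obtain ⟨u, hu, w, hw, huw⟩ := Submodule.mem_sup.1 (hN.sup_eq_top ▸ Submodule.mem_top (x := y.1))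
    obtain ⟨c, hc, _, ⟨d, hd, rfl⟩, rfl⟩ := exists_eq_smul_of_mem_span hD h₀ hu
    refine ⟨⟨(-w, c * d.2 - y.2), neg_mem hw, trivial⟩, ?_⟩
    convert PointedCone.smul_mem (PointedCone.hull ℝ G) hc (Submodule.subset_span hd) using 1
    ext <;> simp [← huw]
  obtain ⟨F, hFf, hF⟩ := riesz_extension _ f nonneg dense
  refine ⟨-F.comp (LinearMap.inl ℝ U ℝ), fun q hq => ?_⟩
  have hvert : F (0, q.2) = q.2 := hFf ⟨(0, q.2), zero_mem N, trivial⟩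
  have hsplit : F q = F (q.1, 0) + F (0, q.2) := by
    rw [← map_add, Prod.fst_add_snd]
  have hpos : 0 ≤ F q := hF _ (Submodule.subset_span hq)
  simp only [LinearMap.neg_apply, LinearMap.comp_apply, LinearMap.inl_apply]
  linarith

theorem exists_lagrange_multiplier {G : Set (Z × ℝ)} (hG : Convex ℝ G) (Q : Z →ₗ[ℝ] U)
    (k : Z →ₗ[ℝ] ℝ) {z₀ : Z} (hz₀ : z₀ ∈ relCore (Prod.fst '' G)) (hQ : Q z₀ = 0) {m : ℝ}
    (hm : ∀ q ∈ G, Q q.1 = 0 → m + k q.1 ≤ q.2) :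
    ∃ ℓ : U →ₗ[ℝ] ℝ, ∀ q ∈ G, m + k q.1 + ℓ (Q q.1) ≤ q.2 := by
  let A : Z × ℝ →ₗ[ℝ] U × ℝ :=
    (Q.comp (LinearMap.fst ℝ Z ℝ)).prod (LinearMap.snd ℝ Z ℝ - k.comp (LinearMap.fst ℝ Z ℝ))
  let a (q : Z × ℝ) : U × ℝ := (0, -m) + A q
  have ha (q : Z × ℝ) : a q = (Q q.1, q.2 - (m + k q.1)) := by
    ext <;> simp [a, A]
    ring
  have hconv : Convex ℝ (a '' G) := by
    simpa only [image_image] using (hG.linear_image A).translate (0, -m)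
  have h₀ : 0 ∈ relCore (Prod.fst '' (a '' G)) := by
    have h := hQ ▸ map_mem_relCore_image Q hz₀
    simpa only [image_image, ha] using h
  obtain ⟨ℓ, hℓ⟩ := exists_linear_minorant hconv h₀ (by
    rintro r ⟨q, hq, hqr⟩
    rw [ha, Prod.mk.injEq] at hqr
    linarith [hm q hq hqr.1])
  refine ⟨ℓ, fun q hq => ?_⟩
  have h := hℓ _ (mem_image_of_mem a hq)
  rw [ha] at h
  linarith

end LagrangeMultiplier

section ERealOrder

theorem exists_coe_eq {φ : EReal} (hbot : ⊥ < φ) (htop : φ < ⊤) : ∃ r : ℝ, φ = r :=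
  ⟨φ.toReal, (EReal.coe_toReal htop.ne hbot.ne').symm⟩

theorem exists_le_coe {φ : EReal} (h : φ < ⊤) : ∃ r : ℝ, φ ≤ r :=
  let ⟨r, hr, _⟩ := EReal.lt_iff_exists_real_btwn.1 h
  ⟨r, hr.le⟩

theorem coe_le_iff_forall_le_coe {a : ℝ} {φ : EReal} :
    (a : EReal) ≤ φ ↔ ∀ s : ℝ, φ ≤ s → a ≤ s :=
  ⟨fun h _ hs => EReal.coe_le_coe_iff.1 (h.trans hs), fun h =>
    EReal.le_of_forall_lt_iff_le.1 fun s hs => EReal.coe_le_coe_iff.2 (h s hs.le)⟩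

theorem eq_of_forall_le_coe_iff {φ ψ : EReal} (h : ∀ r : ℝ, φ ≤ r ↔ ψ ≤ r) : φ = ψ :=
  le_antisymm (EReal.le_of_forall_lt_iff_le.1 fun r hr => (h r).2 hr.le)
    (EReal.le_of_forall_lt_iff_le.1 fun r hr => (h r).1 hr.le)

theorem coe_add_le_coe_iff {a r : ℝ} {φ : EReal} :
    (a : EReal) + φ ≤ r ↔ φ ≤ ((r - a : ℝ) : EReal) := by
  rw [EReal.coe_sub, EReal.le_sub_iff_add_le (.inl (EReal.coe_ne_bot a))
    (.inl (EReal.coe_ne_top a)), add_comm]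

theorem coe_sub_le_coe_iff {a r : ℝ} {φ : EReal} :
    (a : EReal) - φ ≤ r ↔ ∀ s : ℝ, φ ≤ s → a - s ≤ r := by
  rw [EReal.sub_le_iff_le_add (.inr (EReal.coe_ne_top r)) (.inr (EReal.coe_ne_bot r)),
    add_comm, ← EReal.sub_le_iff_le_add (.inl (EReal.coe_ne_bot r)) (.inl (EReal.coe_ne_top r)),
    ← EReal.coe_sub, coe_le_iff_forall_le_coe]
  exact forall₂_congr fun s _ => sub_le_comm

theorem add_le_coe_add_iff {a b : ℝ} {φ ψ : EReal} (ha : (a : EReal) ≤ φ)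
    (hb : (b : EReal) ≤ ψ) : φ + ψ ≤ ((a + b : ℝ) : EReal) ↔ φ ≤ a ∧ ψ ≤ b := by
  rw [EReal.coe_add]
  refine ⟨fun h => ⟨?_, ?_⟩, fun h => add_le_add h.1 h.2⟩
  · exact (EReal.addLECancellable_coe b).add_le_add_iff_right.1 ((add_le_add_right hb φ).trans h)
  · exact (EReal.addLECancellable_coe a).add_le_add_iff_left.1 ((add_le_add_left ha ψ).trans h)

theorem exists_coe_of_add_lt_top {φ ψ : EReal} (hφ : ⊥ < φ) (hψ : ⊥ < ψ) (h : φ + ψ < ⊤) :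
    ∃ a b : ℝ, φ = a ∧ ψ = b := by
  have hne := (EReal.add_ne_top_iff_ne_top₂ hφ.ne' hψ.ne').1 h.ne
  obtain ⟨a, ha⟩ := exists_coe_eq hφ hne.1.lt_top
  obtain ⟨b, hb⟩ := exists_coe_eq hψ hne.2.lt_top
  exact ⟨a, b, ha, hb⟩

theorem add_le_coe_of_forall_lt {φ ψ : EReal} {M : ℝ}
    (h : ∀ a : ℝ, (a : EReal) < φ → ψ ≤ ((M - a : ℝ) : EReal)) : φ + ψ ≤ M := by
  refine EReal.add_le_of_forall_lt fun a ha b hb => ?_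
  obtain ⟨c, hac, hc⟩ := EReal.lt_iff_exists_real_btwn.1 ha
  exact (add_le_add hac.le (hb.le.trans (h c hc))).trans (coe_add_le_coe_iff.2 le_rfl)

variable {ι : Type*} {s : Finset ι} {φ : ι → EReal}

theorem coe_sum (s : Finset ι) (a : ι → ℝ) :
    ((∑ i ∈ s, a i : ℝ) : EReal) = ∑ i ∈ s, (a i : EReal) :=
  map_sum (⟨⟨Real.toEReal, EReal.coe_zero⟩, EReal.coe_add⟩ : ℝ →+ EReal) a s

theorem bot_lt_sum (h : ∀ i ∈ s, ⊥ < φ i) : ⊥ < ∑ i ∈ s, φ i :=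
  Finset.sum_induction φ (⊥ < ·) (fun _ _ ha hb => EReal.bot_lt_add_iff.2 ⟨ha, hb⟩)
    EReal.bot_lt_zero h

theorem sum_le_coe_sum_iff {a : ι → ℝ} (ha : ∀ i ∈ s, (a i : EReal) ≤ φ i) :
    ∑ i ∈ s, φ i ≤ ((∑ i ∈ s, a i : ℝ) : EReal) ↔ ∀ i ∈ s, φ i ≤ a i := by
  classical
  induction s using Finset.induction_on with
  | empty => simp
  | insert i s hi ih =>
    simp only [Finset.forall_mem_insert] at ha ⊢
    have hs : ((∑ j ∈ s, a j : ℝ) : EReal) ≤ ∑ j ∈ s, φ j :=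
      (coe_sum s a).trans_le (Finset.sum_le_sum ha.2)
    rw [Finset.sum_insert hi, Finset.sum_insert hi, add_le_coe_add_iff ha.1 hs, ih ha.2]

theorem sum_le_coe_of_forall_lt {M : ℝ}
    (h : ∀ l : ι → ℝ, (∀ i ∈ s, (l i : EReal) < φ i) → ∑ i ∈ s, l i ≤ M) :
    ∑ i ∈ s, φ i ≤ M := by
  classical
  induction s using Finset.induction_on generalizing M with
  | empty => simpa using h 0
  | insert i s hi ih =>
    rw [Finset.sum_insert hi]
    refine add_le_coe_of_forall_lt fun a ha => ih fun l hl => ?_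
    have hne : ∀ j ∈ s, j ≠ i := fun j hj hji => hi (hji ▸ hj)
    have hsum := h (Function.update l i a) ((Finset.forall_mem_insert _ _ _).2
      ⟨by simpa using ha, fun j hj => by simpa [hne j hj] using hl j hj⟩)
    rw [Finset.sum_insert hi, Function.update_self,
      Finset.sum_congr rfl fun j hj => Function.update_of_ne (hne j hj) a l] at hsum
    linarith

end ERealOrder

section AffineMinorant

variable {X : Type*} [AddCommGroup X] [Module ℝ X] [TopologicalSpace X] {φ : X → EReal}

theorem exists_affine_minorant_of_pos {ℓ : X →L[ℝ] ℝ} {β u r : ℝ} {x : X} (hβ : 0 < β)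
    (hr : ℓ x + β * r < u) (hsep : ∀ z (s : ℝ), φ z ≤ s → u < ℓ z + β * s) :
    ∃ (ℓ' : X →L[ℝ] ℝ) (c : ℝ), r < ℓ' x + c ∧ ∀ z (s : ℝ), φ z ≤ s → ℓ' z + c ≤ s := by
  have hval (z : X) : (-(β⁻¹ • ℓ)) z + u / β = (u - ℓ z) / β := by
    simp only [neg_apply, smul_apply, smul_eq_mul]
    ring
  refine ⟨-(β⁻¹ • ℓ), u / β, ?_, fun z s hs => ?_⟩
  · rw [hval, lt_div_iff₀ hβ]
    linarith
  · rw [hval, div_le_iff₀ hβ]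
    linarith [hsep z s hs]

variable [IsTopologicalAddGroup X] [ContinuousSMul ℝ X] [LocallyConvexSpace ℝ X]

theorem IsProperConvexLsc.exists_separating_hyperplane (hφ : IsProperConvexLsc φ) {x : X} {r : ℝ}
    (hr : (r : EReal) < φ x) : ∃ (ℓ : X →L[ℝ] ℝ) (β u : ℝ), 0 ≤ β ∧ ℓ x + β * r < u ∧
      ∀ z (s : ℝ), φ z ≤ s → u < ℓ z + β * s := by
  obtain ⟨f, u, hfu, hf⟩ := geometric_hahn_banach_point_closed (x := (x, r)) hφ.convex hφ.lsc
    (not_le.2 hr)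
  let ℓ : X →L[ℝ] ℝ := f.comp (ContinuousLinearMap.inl ℝ X ℝ)
  have hsplit (z : X) (s : ℝ) : f (z, s) = ℓ z + f (0, 1) * s := by
    rw [← Prod.fst_add_snd (z, s), map_add, mul_comm, ← smul_eq_mul, ← map_smul]
    simp [ℓ]
  have hsep (z : X) (s : ℝ) (hs : φ z ≤ s) : u < ℓ z + f (0, 1) * s := hsplit z s ▸ hf _ hs
  refine ⟨ℓ, f (0, 1), u, ?_, hsplit x r ▸ hfu, hsep⟩
  obtain ⟨z, hz⟩ := hφ.proper.1
  obtain ⟨s, hs⟩ := exists_le_coe hz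
  by_contra! hneg
  -- Going far enough up above `z` would cross a hyperplane of negative slope.
  obtain ⟨k, hk⟩ := exists_gt (max s ((u - ℓ z) / f (0, 1)))
  have hup := hsep z k (hs.trans (EReal.coe_le_coe_iff.2 ((le_max_left _ _).trans hk.le)))
  have hlt := (div_lt_iff_of_neg' hneg).1 ((le_max_right _ _).trans_lt hk)
  linarith

theorem IsProperConvexLsc.exists_affine_minorant (hφ : IsProperConvexLsc φ) {x : X} {r : ℝ}
    (hr : (r : EReal) < φ x) :
    ∃ (ℓ : X →L[ℝ] ℝ) (c : ℝ), r < ℓ x + c ∧ ∀ z (s : ℝ), φ z ≤ s → ℓ z + c ≤ s := by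
  obtain ⟨ℓ, β, u, hβ, hxu, hsep⟩ := hφ.exists_separating_hyperplane hr
  obtain hβ | rfl := hβ.lt_or_eq
  · exact exists_affine_minorant_of_pos hβ hxu hsep
  -- A vertical hyperplane is tilted by adding a large multiple of it to some affine minorant.
  obtain ⟨x₁, hx₁⟩ := hφ.proper.1
  obtain ⟨s₁, hs₁⟩ := exists_le_coe hx₁
  obtain ⟨r₁, -, hr₁⟩ := EReal.lt_iff_exists_real_btwn.1 (hφ.proper.2 x₁)
  obtain ⟨ℓ₁, β₁, u₁, hβ₁, hxu₁, hsep₁⟩ := hφ.exists_separating_hyperplane hr₁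
  have hβ₁ : 0 < β₁ := hβ₁.lt_of_ne (by
    rintro rfl
    linarith [hsep₁ x₁ s₁ hs₁])
  obtain ⟨ℓ₂, c, -, hminor⟩ := exists_affine_minorant_of_pos hβ₁ hxu₁ hsep₁
  obtain ⟨k, hk⟩ := exists_nat_gt ((r - ℓ₂ x - c) / (u - ℓ x))
  rw [div_lt_iff₀ (by linarith)] at hk
  refine ⟨ℓ₂ - (k : ℝ) • ℓ, c + k * u, ?_, fun z s hs => ?_⟩ <;>
    simp only [sub_apply, smul_apply, smul_eq_mul]
  · linarith
  · have hlt : u < ℓ z := by simpa using hsep z s hs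
    linarith [hminor z s hs, mul_le_mul_of_nonneg_left hlt.le k.cast_nonneg]

end AffineMinorant

/-- The conjugate `φ*(y) = sup_x (B x y - φ x)` with respect to a bilinear pairing `B`. The
conjugates `K_t`, `f`, `H_t(x, ·)` of the problem are all of this form, for different pairings. -/
noncomputable def fenchelConj {X Y : Type*} [AddCommGroup X] [Module ℝ X] [AddCommGroup Y]
    [Module ℝ Y] (B : X →ₗ[ℝ] Y →ₗ[ℝ] ℝ) (φ : X → EReal) (y : Y) : EReal :=
  ⨆ x, (((B x y : ℝ) : EReal) - φ x)

section FenchelConj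

variable {X Y : Type*} [AddCommGroup X] [Module ℝ X] [AddCommGroup Y] [Module ℝ Y]
  {B : X →ₗ[ℝ] Y →ₗ[ℝ] ℝ} {φ : X → EReal}

theorem fenchelConj_le_coe_iff {y : Y} {r : ℝ} :
    fenchelConj B φ y ≤ r ↔ ∀ x (s : ℝ), φ x ≤ s → B x y - s ≤ r := by
  simp only [fenchelConj, iSup_le_iff, coe_sub_le_coe_iff]

theorem exists_coe_lt_of_coe_lt_fenchelConj {y : Y} {r : ℝ} (h : (r : EReal) < fenchelConj B φ y) :
    ∃ x, ∃ s : ℝ, φ x ≤ s ∧ r < B x y - s := by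
  contrapose! h
  exact fenchelConj_le_coe_iff.2 h

theorem convex_epi_fenchelConj (B : X →ₗ[ℝ] Y →ₗ[ℝ] ℝ) (φ : X → EReal) :
    Convex ℝ (epi (fenchelConj B φ)) := by
  rintro ⟨y, r⟩ hy ⟨z, q⟩ hz a b ha hb hab
  refine fenchelConj_le_coe_iff.2 fun x s hs => ?_
  have h₁ : B x y - s ≤ r := fenchelConj_le_coe_iff.1 hy x s hs
  have h₂ : B x z - s ≤ q := fenchelConj_le_coe_iff.1 hz x s hs
  simp only [Prod.smul_mk, Prod.mk_add_mk, map_add, map_smul, smul_eq_mul]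
  linear_combination a * h₁ + b * h₂ + s * hab

theorem bot_lt_fenchelConj (hφ : (dom φ).Nonempty) (y : Y) : ⊥ < fenchelConj B φ y := by
  obtain ⟨x, hx⟩ := hφ
  obtain ⟨s, hs⟩ := exists_le_coe hx
  refine (EReal.bot_lt_coe (B x y - s)).trans_le ?_
  rw [EReal.coe_sub]
  exact le_iSup_of_le x (EReal.sub_le_sub le_rfl hs)

theorem dom_nonempty_of_bot_lt_fenchelConj {y : Y} (h : ⊥ < fenchelConj B φ y) :
    (dom φ).Nonempty := by
  by_contra hempty
  have htop (x : X) : φ x = ⊤ := not_lt_top_iff.1 fun hx => hempty ⟨x, hx⟩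
  simp [fenchelConj, htop] at h

theorem IsProper.coe_le_add_fenchelConj (hφ : IsProper φ) (x : X) (y : Y) :
    ((B x y : ℝ) : EReal) ≤ φ x + fenchelConj B φ y := by
  rw [add_comm, ← EReal.sub_le_iff_le_add (.inl (hφ.2 x).ne')
    (.inr (bot_lt_fenchelConj hφ.1 y).ne')]
  exact le_iSup (fun x => ((B x y : ℝ) : EReal) - φ x) x

theorem IsProperConvexLsc.fenchelConj_fenchelConj [TopologicalSpace X] [IsTopologicalAddGroup X]
    [ContinuousSMul ℝ X] [LocallyConvexSpace ℝ X] (hφ : IsProperConvexLsc φ)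
    (hB : ∀ ℓ : X →L[ℝ] ℝ, ∃ y, ∀ x, B x y = ℓ x) :
    fenchelConj B.flip (fenchelConj B φ) = φ := by
  ext x
  refine le_antisymm (iSup_le fun y =>
    EReal.sub_le_of_le_add (hφ.proper.coe_le_add_fenchelConj x y)) ?_
  refine EReal.ge_of_forall_gt_iff_ge.1 fun r hr => ?_
  obtain ⟨ℓ, c, hrc, hminor⟩ := hφ.exists_affine_minorant hr
  obtain ⟨y, hy⟩ := hB ℓ
  have hconj : fenchelConj B φ y ≤ ((-c : ℝ) : EReal) :=
    fenchelConj_le_coe_iff.2 fun z s hs => by linarith [hminor z s hs, hy z]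
  calc (r : EReal) ≤ ((B x y - -c : ℝ) : EReal) := EReal.coe_le_coe_iff.2 (by linarith [hy x])
    _ ≤ B x y - fenchelConj B φ y := by
      rw [EReal.coe_sub]
      exact EReal.sub_le_sub le_rfl hconj
    _ ≤ fenchelConj B.flip (fenchelConj B φ) x :=
      le_iSup (fun y => ((B.flip y x : ℝ) : EReal) - fenchelConj B φ y) y

end FenchelConj

section DualData

variable {n : ℕ} {L : ℕ → E n → E n → EReal} {g : E n → EReal} {t : ℕ}

/-- The pairing `⟨(x, v), (p, w)⟩ = x · w + v · (p + w)` of stage states and velocities, under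
which `(p, w) ↦ K_t(p + w, w)` is the conjugate of `L_t`. It is symmetric, which makes the dual
problem a problem of the same kind whose own dual is the original one. -/
noncomputable def stagePairing (n : ℕ) : E n × E n →ₗ[ℝ] E n × E n →ₗ[ℝ] ℝ :=
  LinearMap.mk₂ ℝ (fun q q' => inner ℝ q.1 q'.2 + inner ℝ q.2 (q'.1 + q'.2))
    (fun _ _ _ => by
      simp only [Prod.fst_add, Prod.snd_add, inner_add_left]
      ring)
    (fun _ _ _ => by
      simp only [Prod.smul_fst, Prod.smul_snd, real_inner_smul_left, smul_eq_mul]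
      ring)
    (fun _ _ _ => by
      simp only [Prod.fst_add, Prod.snd_add, inner_add_right]
      ring)
    (fun _ _ _ => by
      simp only [Prod.smul_fst, Prod.smul_snd, inner_add_right, real_inner_smul_right, smul_eq_mul]
      ring)

theorem stagePairing_apply (x v p w : E n) :
    stagePairing n (x, v) (p, w) = inner ℝ x w + inner ℝ v (p + w) := rfl

theorem stagePairing_flip : (stagePairing n).flip = stagePairing n := by
  refine LinearMap.ext fun ⟨p, w⟩ => LinearMap.ext fun ⟨x, v⟩ => ?_
  simp only [LinearMap.flip_apply, stagePairing_apply, inner_add_right, real_inner_comm]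
  ring

/-- The dual Lagrangian in the coordinates `(p_{t-1}, Δp_t)`, that is, `K_t(p + w, w)`: the dual
problem is the problem of Bolza for this Lagrangian and the terminal cost `f`. -/
noncomputable def dualStage (L : ℕ → E n → E n → EReal) (t : ℕ) (p w : E n) : EReal :=
  dualLagrangian L t (p + w) w

theorem dualStage_eq_fenchelConj (L : ℕ → E n → E n → EReal) (t : ℕ) (p w : E n) :
    dualStage L t p w = fenchelConj (stagePairing n) (fun q => L t q.1 q.2) (p, w) := by
  simp only [dualStage, dualLagrangian, fenchelConj, iSup_prod, stagePairing_apply, EReal.coe_add]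
  rfl

theorem dualTerminal_eq_fenchelConj (g : E n → EReal) :
    dualTerminal g = fenchelConj (-innerₗ (E n)) g := by
  ext b
  simp only [dualTerminal, conj, dot, inner_neg_right]
  rfl

theorem exists_inner_eq (ℓ : E n →L[ℝ] ℝ) : ∃ p, ∀ x, inner ℝ x p = ℓ x :=
  ⟨(InnerProductSpace.toDual ℝ (E n)).symm ℓ, fun x => by
    rw [real_inner_comm, InnerProductSpace.toDual_symm_apply]⟩

theorem exists_stagePairing_eq (ℓ : E n × E n →L[ℝ] ℝ) : ∃ q, ∀ z, stagePairing n z q = ℓ z := by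
  obtain ⟨w, hw⟩ := exists_inner_eq (ℓ.comp (ContinuousLinearMap.inl ℝ (E n) (E n)))
  obtain ⟨p, hp⟩ := exists_inner_eq (ℓ.comp (ContinuousLinearMap.inr ℝ (E n) (E n)))
  refine ⟨(p - w, w), fun ⟨x, v⟩ => ?_⟩
  rw [stagePairing_apply, sub_add_cancel, hw, hp, ← Prod.fst_add_snd (x, v), map_add]
  rfl

theorem dualStage_dualStage (hL : IsProperConvexLsc fun q : E n × E n => L t q.1 q.2) (x v : E n) :
    dualStage (dualStage L) t x v = L t x v := by
  simp only [dualStage_eq_fenchelConj (dualStage L), dualStage_eq_fenchelConj L]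
  have h := congrFun (hL.fenchelConj_fenchelConj exists_stagePairing_eq) (x, v)
  rwa [stagePairing_flip] at h

theorem dualTerminal_dualTerminal (hg : IsProperConvexLsc g) :
    dualTerminal (dualTerminal g) = g := by
  have hflip : (-innerₗ (E n)).flip = -innerₗ (E n) := by
    refine LinearMap.ext fun x => LinearMap.ext fun y => ?_
    simp [real_inner_comm]
  rw [dualTerminal_eq_fenchelConj, dualTerminal_eq_fenchelConj]
  nth_rw 1 [← hflip]
  refine hg.fenchelConj_fenchelConj fun ℓ => ?_
  obtain ⟨p, hp⟩ := exists_inner_eq ℓ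
  exact ⟨-p, fun x => by simp [hp]⟩

end DualData

section Subdifferential

variable {n : ℕ} {L : ℕ → E n → E n → EReal} {g : E n → EReal} {t : ℕ}

theorem conj_eq_fenchelConj (φ : E n → EReal) : conj φ = fenchelConj (innerₗ (E n)) φ := rfl

theorem conj_le_coe_iff {φ : E n → EReal} {y : E n} {r : ℝ} :
    conj φ y ≤ r ↔ ∀ x (s : ℝ), φ x ≤ s → inner ℝ x y - s ≤ r := by
  simp only [conj_eq_fenchelConj, fenchelConj_le_coe_iff, innerₗ_apply_apply]

theorem bot_lt_conj {φ : E n → EReal} (hφ : (dom φ).Nonempty) (y : E n) : ⊥ < conj φ y := by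
  rw [conj_eq_fenchelConj]
  exact bot_lt_fenchelConj hφ y

theorem mem_subdiff_iff_of_eq_coe {φ : E n → EReal} {x y : E n} {a : ℝ} (hx : φ x = a) :
    y ∈ subdiff φ x ↔ conj φ y ≤ ((inner ℝ x y - a : ℝ) : EReal) := by
  have hdom : x ∈ dom φ := by
    rw [dom, mem_ofPred_eq, hx]
    exact EReal.coe_lt_top a
  simp only [subdiff, mem_ofPred_eq, hdom, true_and, hx, dot, ← EReal.coe_add,
    coe_le_iff_forall_le_coe, conj_le_coe_iff, inner_sub_right, real_inner_comm]
  exact forall₃_congr fun z s _ => ⟨fun h => by linarith, fun h => by linarith⟩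

theorem IsProper.mem_subdiff_iff {φ : E n → EReal} (hφ : IsProper φ) {x y : E n} :
    y ∈ subdiff φ x ↔ φ x + conj φ y ≤ ((inner ℝ x y : ℝ) : EReal) := by
  have hreal : y ∈ subdiff φ x ∨ φ x + conj φ y ≤ ((inner ℝ x y : ℝ) : EReal) → φ x < ⊤ := by
    rintro (h | h)
    · exact h.1
    · obtain ⟨a, -, ha, -⟩ := exists_coe_of_add_lt_top (hφ.2 x) (bot_lt_conj hφ.1 y)
        (h.trans_lt (EReal.coe_lt_top _))
      exact ha ▸ EReal.coe_lt_top a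
  by_cases hx : φ x < ⊤
  · obtain ⟨a, ha⟩ := exists_coe_eq (hφ.2 x) hx
    rw [mem_subdiff_iff_of_eq_coe ha, ha, coe_add_le_coe_iff]
  · exact iff_of_false (fun h => hx (hreal (.inl h))) fun h => hx (hreal (.inr h))

theorem neg_mem_subdiff_iff (hg : IsProper g) {x p : E n} :
    -p ∈ subdiff g x ↔ g x + dualTerminal g p ≤ ((-inner ℝ x p : ℝ) : EReal) := by
  rw [hg.mem_subdiff_iff, inner_neg_right, dualTerminal]

theorem hamiltonian_eq_fenchelConj (L : ℕ → E n → E n → EReal) (t : ℕ) (x : E n) :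
    hamiltonian L t x = fenchelConj (innerₗ (E n)).flip (L t x) := rfl

theorem IsProperConvexLsc.fibre {X Y : Type*} [AddCommGroup X] [Module ℝ X] [TopologicalSpace X]
    [AddCommGroup Y] [Module ℝ Y] [TopologicalSpace Y] {F : X → Y → EReal}
    (hF : IsProperConvexLsc fun q : X × Y => F q.1 q.2) {x : X} (hx : (dom (F x)).Nonempty) :
    IsProperConvexLsc (F x) where
  proper := ⟨hx, fun v => hF.proper.2 (x, v)⟩
  convex := by
    rintro ⟨v, r⟩ hv ⟨w, s⟩ hw a b ha hb hab
    have h := hF.convex (x := ((x, v), r)) hv (y := ((x, w), s)) hw ha hb hab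
    simpa [epi, Convex.combo_self hab] using h
  lsc := hF.lsc.preimage (f := fun q : Y × ℝ => ((x, q.1), q.2)) (by fun_prop)

theorem conj_hamiltonian (hL : IsProperConvexLsc fun q : E n × E n => L t q.1 q.2) {x : E n}
    (hx : (dom (L t x)).Nonempty) : conj (hamiltonian L t x) = L t x := by
  have hB (ℓ : E n →L[ℝ] ℝ) : ∃ p, ∀ v, (innerₗ (E n)).flip v p = ℓ v := by
    obtain ⟨p, hp⟩ := exists_inner_eq ℓ
    exact ⟨p, fun v => by rw [LinearMap.flip_apply, innerₗ_apply_apply, real_inner_comm, hp]⟩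
  rw [conj_eq_fenchelConj, hamiltonian_eq_fenchelConj]
  exact (hL.fibre hx).fenchelConj_fenchelConj hB

theorem conj_neg_hamiltonian (L : ℕ → E n → E n → EReal) (t : ℕ) (p w : E n) :
    conj (fun x => -hamiltonian L t x p) w = dualLagrangian L t p w := by
  refine eq_of_forall_le_coe_iff fun r => ?_
  have hcancel (x : E n) : dot x w - -hamiltonian L t x p ≤ r ↔
      hamiltonian L t x p ≤ ((r - inner ℝ x w : ℝ) : EReal) := by
    rw [sub_eq_add_neg, neg_neg, dot, coe_add_le_coe_iff]
  simp only [conj, dualLagrangian, iSup_le_iff, hcancel]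
  simp only [hamiltonian, dot, iSup_le_iff, ← EReal.coe_add, coe_sub_le_coe_iff]
  refine forall₄_congr fun x v s _ => ?_
  rw [real_inner_comm v p]
  exact ⟨fun h => by linarith, fun h => by linarith⟩

theorem inner_add_hamiltonian_le_dualLagrangian (L : ℕ → E n → E n → EReal) (t : ℕ)
    (x p w : E n) :
    ((inner ℝ x w : ℝ) : EReal) + hamiltonian L t x p ≤ dualLagrangian L t p w := by
  rw [← conj_neg_hamiltonian, ← neg_neg (hamiltonian L t x p), ← sub_eq_add_neg]
  exact le_iSup (fun x => dot x w - -hamiltonian L t x p) x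

theorem mem_saddleSubdiff_hamiltonian_iff_of_eq_coe
    (hL : IsProperConvexLsc fun q : E n × E n => L t q.1 q.2) {x p w v : E n} {r : ℝ}
    (hr : hamiltonian L t x p = r) : (-w, v) ∈ saddleSubdiff (hamiltonian L t) x p ↔
      L t x v + dualLagrangian L t p w ≤ ((inner ℝ x w + inner ℝ v p : ℝ) : EReal) := by
  have hdom : (dom (L t x)).Nonempty := by
    refine dom_nonempty_of_bot_lt_fenchelConj (B := (innerₗ (E n)).flip) (y := p) ?_
    rw [← hamiltonian_eq_fenchelConj, hr]
    exact EReal.bot_lt_coe r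
  have hv : conj (hamiltonian L t x) v = L t x v := by rw [conj_hamiltonian hL hdom]
  have hlower_v : ((inner ℝ p v - r : ℝ) : EReal) ≤ L t x v := by
    rw [← hv, EReal.coe_sub, ← hr]
    exact le_iSup (fun p => dot p v - hamiltonian L t x p) p
  have hlower_w : ((inner ℝ x w - -r : ℝ) : EReal) ≤ dualLagrangian L t p w := by
    rw [sub_neg_eq_add, EReal.coe_add, ← hr]
    exact inner_add_hamiltonian_le_dualLagrangian L t x p w
  have hneg : -hamiltonian L t x p = ((-r : ℝ) : EReal) := by rw [hr, EReal.coe_neg]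
  have hsum : (inner ℝ x w + inner ℝ v p : ℝ) = (inner ℝ p v - r) + (inner ℝ x w - -r) := by
    rw [real_inner_comm v p]
    ring
  rw [hsum, add_le_coe_add_iff hlower_v hlower_w, saddleSubdiff, mem_ofPred_eq, neg_neg,
    mem_subdiff_iff_of_eq_coe hneg, mem_subdiff_iff_of_eq_coe hr, hv, conj_neg_hamiltonian,
    and_comm]

theorem exists_hamiltonian_eq_coe_of_mem_saddleSubdiff {q : E n × E n} {x p : E n}
    (h : q ∈ saddleSubdiff (hamiltonian L t) x p) : ∃ r : ℝ, hamiltonian L t x p = r := by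
  obtain ⟨⟨hneg, -⟩, ⟨hpos, -⟩⟩ := h
  refine exists_coe_eq (bot_lt_iff_ne_bot.2 fun hbot => ?_) hpos
  simp [dom, hbot] at hneg

theorem exists_hamiltonian_eq_coe_of_add_lt_top (hL : IsProper fun q : E n × E n => L t q.1 q.2)
    {x p w v : E n} (h : L t x v + dualLagrangian L t p w < ⊤) :
    ∃ r : ℝ, hamiltonian L t x p = r := by
  have hK : ⊥ < dualLagrangian L t p w := by
    have hp := bot_lt_fenchelConj (B := stagePairing n) hL.1 (p - w, w)
    rwa [← dualStage_eq_fenchelConj, dualStage, sub_add_cancel] at hp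
  obtain ⟨a, b, ha, hb⟩ := exists_coe_of_add_lt_top (hL.2 (x, v)) hK h
  refine exists_coe_eq ?_ ?_
  · rw [hamiltonian_eq_fenchelConj]
    exact bot_lt_fenchelConj ⟨v, ha.trans_lt (EReal.coe_lt_top a)⟩ p
  · have hle := hb ▸ inner_add_hamiltonian_le_dualLagrangian L t x p w
    exact (coe_add_le_coe_iff.1 hle).trans_lt (EReal.coe_lt_top _)

theorem mem_saddleSubdiff_hamiltonian_iff
    (hL : IsProperConvexLsc fun q : E n × E n => L t q.1 q.2) {x p w v : E n} :
    (-w, v) ∈ saddleSubdiff (hamiltonian L t) x p ↔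
      L t x v + dualLagrangian L t p w ≤ ((inner ℝ x w + inner ℝ v p : ℝ) : EReal) := by
  by_cases hreal : ∃ r : ℝ, hamiltonian L t x p = r
  · obtain ⟨r, hr⟩ := hreal
    exact mem_saddleSubdiff_hamiltonian_iff_of_eq_coe hL hr
  · exact iff_of_false
      (fun h => hreal (exists_hamiltonian_eq_coe_of_mem_saddleSubdiff h))
      fun h => hreal (exists_hamiltonian_eq_coe_of_add_lt_top hL.proper
        (h.trans_lt (EReal.coe_lt_top _)))

end Subdifferential

section BolzaDuality

variable {n T τ : ℕ} {L : ℕ → E n → E n → EReal} {g : E n → EReal}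

theorem sum_inner_diff (hτ : τ ≤ T) (x p : ℕ → E n) :
    ∑ t ∈ Finset.Icc (τ + 1) T, ((inner ℝ (x (t - 1)) (diff p t) : ℝ) + inner ℝ (diff x t) (p t)) =
      inner ℝ (x T) (p T) - inner ℝ (x τ) (p τ) := by
  induction T, hτ using Nat.le_induction with
  | base => simp
  | succ T hT ih =>
    rw [Finset.sum_Icc_succ_top (by omega), ih]
    simp only [diff, Nat.add_sub_cancel, inner_sub_left, inner_sub_right]
    ring

theorem FullyConvex.lagrangian_of_mem (h : FullyConvex T L g) {t : ℕ}
    (ht : t ∈ Finset.Icc (τ + 1) T) : IsProperConvexLsc fun q : E n × E n => L t q.1 q.2 :=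
  h.lagrangian t (Finset.Icc_subset_Icc_left (Nat.le_add_left 1 τ) ht)

theorem add_diff (p : ℕ → E n) (t : ℕ) : p (t - 1) + diff p t = p t :=
  add_sub_cancel _ _

theorem cost_add_cost (F G : ℕ → E n → E n → EReal) (g f : E n → EReal) (x p : ℕ → E n) :
    cost T F g τ x + cost T G f τ p =
      ∑ t ∈ Finset.Icc (τ + 1) T, (F t (x (t - 1)) (diff x t) + G t (p (t - 1)) (diff p t)) +
        (g (x T) + f (p T)) := by
  rw [cost, cost, Finset.sum_add_distrib, add_add_add_comm]

theorem bot_lt_cost {F : ℕ → E n → E n → EReal} {h : E n → EReal}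
    (hF : ∀ t ∈ Finset.Icc (τ + 1) T, ∀ x v, ⊥ < F t x v) (hh : ∀ x, ⊥ < h x) (x : ℕ → E n) :
    ⊥ < cost T F h τ x :=
  EReal.bot_lt_add_iff.2 ⟨bot_lt_sum fun t ht => hF t ht _ _, hh _⟩

theorem FullyConvex.inner_le_stage_add_dualStage (hA : FullyConvex T L g) {t : ℕ}
    (ht : t ∈ Finset.Icc (τ + 1) T) (x p : ℕ → E n) :
    ((inner ℝ (x (t - 1)) (diff p t) + inner ℝ (diff x t) (p t) : ℝ) : EReal) ≤
      L t (x (t - 1)) (diff x t) + dualStage L t (p (t - 1)) (diff p t) := by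
  have h := (hA.lagrangian_of_mem ht).proper.coe_le_add_fenchelConj (B := stagePairing n)
    (x (t - 1), diff x t) (p (t - 1), diff p t)
  rwa [← dualStage_eq_fenchelConj, stagePairing_apply, add_diff] at h

theorem FullyConvex.neg_inner_le_terminal_add_dualTerminal (hA : FullyConvex T L g) (x p : E n) :
    ((-inner ℝ x p : ℝ) : EReal) ≤ g x + dualTerminal g p := by
  rw [dualTerminal_eq_fenchelConj]
  exact hA.terminal.proper.coe_le_add_fenchelConj (B := -innerₗ (E n)) x p

theorem neg_inner_eq_sum_add (hτ : τ ≤ T) (x p : ℕ → E n) :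
    -inner ℝ (x τ) (p τ) = ∑ t ∈ Finset.Icc (τ + 1) T,
      ((inner ℝ (x (t - 1)) (diff p t) : ℝ) + inner ℝ (diff x t) (p t)) + -inner ℝ (x T) (p T) := by
  rw [sum_inner_diff hτ]
  ring

theorem FullyConvex.neg_inner_le_cost_add_cost (hA : FullyConvex T L g) (hτ : τ ≤ T)
    (x p : ℕ → E n) : ((-inner ℝ (x τ) (p τ) : ℝ) : EReal) ≤
      cost T L g τ x + cost T (dualStage L) (dualTerminal g) τ p := by
  rw [neg_inner_eq_sum_add hτ, cost_add_cost, EReal.coe_add, coe_sum]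
  exact add_le_add (Finset.sum_le_sum fun t ht => hA.inner_le_stage_add_dualStage ht x p)
    (hA.neg_inner_le_terminal_add_dualTerminal _ _)

theorem FullyConvex.cost_add_cost_le_iff (hA : FullyConvex T L g) (hτ : τ ≤ T) (x p : ℕ → E n) :
    cost T L g τ x + cost T (dualStage L) (dualTerminal g) τ p ≤
      ((-inner ℝ (x τ) (p τ) : ℝ) : EReal) ↔
      IsHamiltonianTrajectory T L τ x p ∧ -p T ∈ subdiff g (x T) := by
  have hstage := fun t ht => hA.inner_le_stage_add_dualStage (τ := τ) (t := t) ht x p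
  have hsum := (coe_sum _ _).trans_le (Finset.sum_le_sum hstage)
  rw [neg_inner_eq_sum_add hτ, cost_add_cost,
    add_le_coe_add_iff hsum (hA.neg_inner_le_terminal_add_dualTerminal _ _),
    sum_le_coe_sum_iff hstage, neg_mem_subdiff_iff hA.terminal.proper]
  refine and_congr_left' (forall₂_congr fun t ht => ?_)
  rw [mem_saddleSubdiff_hamiltonian_iff (hA.lagrangian_of_mem ht), dualStage, add_diff]

end BolzaDuality

/-- The epigraph of the cost as a function of independent states `y` and velocities `v`, that is,
before the dynamics `v_t = Δy_t` are imposed. -/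
def decoupledEpi {n : ℕ} (T : ℕ) (F : ℕ → E n → E n → EReal) (h : E n → EReal) (τ : ℕ) :
    Set (((ℕ → E n) × (ℕ → E n)) × ℝ) :=
  {q | ∃ (a : ℕ → ℝ) (b : ℝ), (∀ t ∈ Finset.Icc (τ + 1) T, F t (q.1.1 (t - 1)) (q.1.2 t) ≤ a t) ∧
    h (q.1.1 T) ≤ b ∧ q.2 = ∑ t ∈ Finset.Icc (τ + 1) T, a t + b}

section StrongDuality

variable {n T τ : ℕ} {F : ℕ → E n → E n → EReal} {h : E n → EReal}

theorem convex_decoupledEpi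
    (hF : ∀ t ∈ Finset.Icc (τ + 1) T, Convex ℝ (epi fun q : E n × E n => F t q.1 q.2))
    (hh : Convex ℝ (epi h)) : Convex ℝ (decoupledEpi T F h τ) := by
  rintro ⟨⟨y, v⟩, r⟩ ⟨a, b, ha, hb, hr⟩ ⟨⟨y', v'⟩, r'⟩ ⟨a', b', ha', hb', hr'⟩ c d hc hd hcd
  refine ⟨c • a + d • a', c * b + d * b', fun t ht => ?_, ?_, ?_⟩
  · exact hF t ht (x := ((y (t - 1), v t), a t)) (ha t ht) (y := ((y' (t - 1), v' t), a' t))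
      (ha' t ht) hc hd hcd
  · exact hh (x := (y T, b)) hb (y := (y' T, b')) hb' hc hd hcd
  · dsimp only at hr hr'
    simp only [Prod.smul_mk, Prod.mk_add_mk, Pi.add_apply, Pi.smul_apply, smul_eq_mul,
      Finset.sum_add_distrib, ← Finset.mul_sum, hr, hr']
    ring

theorem image_fst_decoupledEpi : Prod.fst '' decoupledEpi T F h τ =
    (⋂ t ∈ Finset.Icc (τ + 1) T,
      {z | (z.1 (t - 1), z.2 t) ∈ dom fun q : E n × E n => F t q.1 q.2}) ∩ {z | z.1 T ∈ dom h} := by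
  ext ⟨y, v⟩
  simp only [mem_inter_iff, mem_iInter₂]
  constructor
  · rintro ⟨⟨_, r⟩, ⟨a, b, ha, hb, -⟩, rfl⟩
    exact ⟨fun t ht => (ha t ht).trans_lt (EReal.coe_lt_top _), hb.trans_lt (EReal.coe_lt_top _)⟩
  · rintro ⟨hy, hT⟩
    exact ⟨((y, v), _), ⟨fun t => (F t (y (t - 1)) (v t)).toReal, (h (y T)).toReal,
      fun t ht => EReal.le_coe_toReal (hy t ht).ne, EReal.le_coe_toReal (ne_of_lt hT), rfl⟩, rfl⟩

theorem convex_dom {X : Type*} [AddCommGroup X] [Module ℝ X] {φ : X → EReal}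
    (hφ : Convex ℝ (epi φ)) : Convex ℝ (dom φ) := by
  have hdom : dom φ = LinearMap.fst ℝ X ℝ '' epi φ := by
    ext x
    refine ⟨fun hx => ?_, ?_⟩
    · obtain ⟨r, hr⟩ := exists_le_coe hx
      exact ⟨(x, r), hr, rfl⟩
    · rintro ⟨q, hq, rfl⟩
      exact (show φ q.1 ≤ q.2 from hq).trans_lt (EReal.coe_lt_top _)
  rw [hdom]
  exact hφ.linear_image _

theorem primalDynamics_eq_preimage_dom {t : ℕ} (hF : ∀ x v, ⊥ < F t x v) (x : E n) :
    primalDynamics F t x = Prod.mk x ⁻¹' dom fun q : E n × E n => F t q.1 q.2 := by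
  ext v
  exact ⟨fun ⟨r, hr⟩ => hr.trans_lt (EReal.coe_lt_top r), fun hv => exists_coe_eq (hF x v) hv⟩

theorem primalStates_eq_image_dom {t : ℕ} (hF : ∀ x v, ⊥ < F t x v) :
    primalStates F t = Prod.fst '' dom fun q : E n × E n => F t q.1 q.2 := by
  ext x
  simp [primalStates, primalDynamics_eq_preimage_dom hF, Set.Nonempty]

theorem mk_mem_relCore_dom {t : ℕ} (hbot : ∀ x v, ⊥ < F t x v)
    (hconv : Convex ℝ (epi fun q : E n × E n => F t q.1 q.2)) {x v : E n}
    (hx : x ∈ intrinsicInterior ℝ (primalStates F t))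
    (hv : v ∈ intrinsicInterior ℝ (primalDynamics F t x)) :
    (x, v) ∈ relCore (dom fun q : E n × E n => F t q.1 q.2) := by
  refine mk_mem_relCore (convex_dom hconv) ?_ ?_
  · rw [← primalStates_eq_image_dom hbot]
    exact intrinsicInterior_subset_relCore _ hx
  · rw [← primalDynamics_eq_preimage_dom hbot]
    exact intrinsicInterior_subset_relCore _ hv

theorem PrimalQualification.exists_mem_relCore (hq : PrimalQualification T F h)
    (hbot : ∀ t ∈ Finset.Icc (τ + 1) T, ∀ x v, ⊥ < F t x v)
    (hconv : ∀ t ∈ Finset.Icc (τ + 1) T, Convex ℝ (epi fun q : E n × E n => F t q.1 q.2)) :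
    ∃ x, (x, diff x) ∈ relCore (Prod.fst '' decoupledEpi T F h τ) := by
  obtain ⟨x, hT, hx⟩ := hq
  let states := LinearMap.fst ℝ (ℕ → E n) (ℕ → E n)
  let velocities := LinearMap.snd ℝ (ℕ → E n) (ℕ → E n)
  refine ⟨x, ?_⟩
  rw [image_fst_decoupledEpi]
  refine mem_relCore_inter (mem_relCore_biInter fun t ht => ?_) ?_
  · obtain ⟨hstate, hvelocity⟩ := hx t (Finset.Icc_subset_Icc_left (Nat.le_add_left 1 τ) ht)
    exact mem_relCore_preimage
      ((LinearMap.proj (t - 1) ∘ₗ states).prod (LinearMap.proj t ∘ₗ velocities))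
      (mk_mem_relCore_dom (hbot t ht) (hconv t ht) hstate hvelocity)
  · exact mem_relCore_preimage (x := (x, diff x)) (LinearMap.proj T ∘ₗ states)
      (intrinsicInterior_subset_relCore (dom h) hT)

theorem exists_sum_inner_eq {ι : Type*} [Fintype ι] (ℓ : (ι → E n) →ₗ[ℝ] ℝ) :
    ∃ p : ι → E n, ∀ u, ∑ i, inner ℝ (u i) (p i) = ℓ u := by
  classical
  choose p hp using fun i => exists_inner_eq
    (LinearMap.toContinuousLinearMap (ℓ ∘ₗ LinearMap.single ℝ (fun _ => E n) i))
  refine ⟨p, fun u => ?_⟩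
  rw [← Finset.univ_sum_single u, map_sum, Finset.univ_sum_single u]
  exact Finset.sum_congr rfl fun i _ => hp i (u i)

theorem cost_le_of_mem_decoupledEpi {q : ((ℕ → E n) × (ℕ → E n)) × ℝ}
    (hq : q ∈ decoupledEpi T F h τ) (hdiff : ∀ t ∈ Finset.Icc (τ + 1) T, q.1.2 t = diff q.1.1 t) :
    cost T F h τ q.1.1 ≤ (q.2 : EReal) := by
  obtain ⟨a, b, ha, hb, hr⟩ := hq
  rw [hr, EReal.coe_add, coe_sum]
  exact add_le_add (Finset.sum_le_sum fun t ht => hdiff t ht ▸ ha t ht) hb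

theorem PrimalQualification.exists_adjoint_arc (hq : PrimalQualification T F h)
    (hbot : ∀ t ∈ Finset.Icc (τ + 1) T, ∀ x v, ⊥ < F t x v)
    (hconv : ∀ t ∈ Finset.Icc (τ + 1) T, Convex ℝ (epi fun q : E n × E n => F t q.1 q.2))
    (hh : Convex ℝ (epi h)) {η : E n} {m : ℝ}
    (hm : ∀ y, ((m + inner ℝ η (y τ) : ℝ) : EReal) ≤ cost T F h τ y) :
    ∃ p : ℕ → E n, p τ = -η ∧ ∀ q ∈ decoupledEpi T F h τ,
      m + inner ℝ η (q.1.1 τ) + ∑ t ∈ Finset.Icc (τ + 1) T,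
        inner ℝ (q.1.2 t - diff q.1.1 t) (p t) ≤ q.2 := by
  let evalAt (t : ℕ) : (ℕ → E n) →ₗ[ℝ] E n := LinearMap.proj t
  let states := LinearMap.fst ℝ (ℕ → E n) (ℕ → E n)
  let velocities := LinearMap.snd ℝ (ℕ → E n) (ℕ → E n)
  let defect : (ℕ → E n) × (ℕ → E n) →ₗ[ℝ] (Finset.Icc (τ + 1) T → E n) :=
    LinearMap.pi fun t => evalAt t ∘ₗ velocities - (evalAt t - evalAt (t - 1)) ∘ₗ states
  have hdefect (z : (ℕ → E n) × (ℕ → E n)) (t : Finset.Icc (τ + 1) T) :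
      defect z t = z.2 t - diff z.1 t := rfl
  have hle : ∀ q ∈ decoupledEpi T F h τ, defect q.1 = 0 → m + inner ℝ η (q.1.1 τ) ≤ q.2 :=
    fun q hq h0 => EReal.coe_le_coe_iff.1 <| (hm q.1.1).trans <|
      cost_le_of_mem_decoupledEpi hq fun t ht => sub_eq_zero.1 (congrFun h0 ⟨t, ht⟩)
  obtain ⟨x, hx⟩ := hq.exists_mem_relCore hbot hconv
  have hx0 : defect (x, diff x) = 0 := funext fun t => by
    rw [hdefect]
    exact sub_self _
  obtain ⟨ℓ, hℓ⟩ := exists_lagrange_multiplier (convex_decoupledEpi hconv hh) defect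
    (innerₗ (E n) η ∘ₗ evalAt τ ∘ₗ states) hx hx0 hle
  obtain ⟨p, hp⟩ := exists_sum_inner_eq ℓ
  refine ⟨fun t => if ht : t ∈ Finset.Icc (τ + 1) T then p ⟨t, ht⟩ else -η, by simp, ?_⟩
  intro q hq
  have hsum : ∑ t ∈ Finset.Icc (τ + 1) T, inner ℝ (q.1.2 t - diff q.1.1 t)
      (if ht : t ∈ Finset.Icc (τ + 1) T then p ⟨t, ht⟩ else -η) = ℓ (defect q.1) := by
    rw [← hp, ← Finset.sum_coe_sort]
    exact Finset.sum_congr rfl fun t _ => by rw [dif_pos t.2, hdefect]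
  rw [hsum]
  exact hℓ q hq

theorem cost_dual_le_of_adjoint (hτ : τ ≤ T) {p : ℕ → E n} {m : ℝ}
    (hp : ∀ q ∈ decoupledEpi T F h τ, m - inner ℝ (q.1.1 τ) (p τ) +
      ∑ t ∈ Finset.Icc (τ + 1) T, inner ℝ (q.1.2 t - diff q.1.1 t) (p t) ≤ q.2) :
    cost T (dualStage F) (dualTerminal h) τ p ≤ ((-m : ℝ) : EReal) := by
  rw [cost, add_comm]
  refine add_le_coe_of_forall_lt fun c hc => sum_le_coe_of_forall_lt fun l hl => ?_
  rw [dualTerminal_eq_fenchelConj] at hc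
  obtain ⟨e, b, hb, hcb⟩ := exists_coe_lt_of_coe_lt_fenchelConj hc
  have hstage (t : ℕ) : t ∈ Finset.Icc (τ + 1) T → ∃ (y v : E n) (a : ℝ),
      F t y v ≤ a ∧ l t < inner ℝ y (diff p t) + inner ℝ v (p t) - a := by
    intro ht
    have hlt := hl t ht
    rw [dualStage_eq_fenchelConj] at hlt
    obtain ⟨⟨y, v⟩, a, ha, hla⟩ := exists_coe_lt_of_coe_lt_fenchelConj hlt
    rw [stagePairing_apply, add_diff] at hla
    exact ⟨y, v, a, ha, hla⟩
  choose! y v a ha hla using hstage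
  let z (s : ℕ) : E n := if s = T then e else y (s + 1)
  have hzT : z T = e := if_pos rfl
  have hz (t : ℕ) (ht : t ∈ Finset.Icc (τ + 1) T) : z (t - 1) = y t := by
    obtain ⟨hτt, htT⟩ := Finset.mem_Icc.1 ht
    simp only [z]
    rw [if_neg (by omega), Nat.sub_add_cancel (by omega)]
  have hadj := hp ((z, v), _)
    ⟨a, b, fun t ht => by simpa only [hz t ht] using ha t ht, by simpa only [hzT] using hb, rfl⟩
  have hparts := sum_inner_diff hτ z p
  have hsum := Finset.sum_le_sum fun t ht => (hla t ht).le
  have hzy : ∑ t ∈ Finset.Icc (τ + 1) T, inner ℝ (z (t - 1)) (diff p t) =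
      ∑ t ∈ Finset.Icc (τ + 1) T, (inner ℝ (y t) (diff p t) : ℝ) :=
    Finset.sum_congr rfl fun t ht => by rw [hz t ht]
  simp only [inner_sub_left, Finset.sum_sub_distrib, Finset.sum_add_distrib, hzT, hzy]
    at hadj hparts hsum
  have hce : c < -inner ℝ e (p T) - b := hcb
  linarith

theorem PrimalQualification.exists_dual_arc (hτ : τ ≤ T) (hq : PrimalQualification T F h)
    (hbot : ∀ t ∈ Finset.Icc (τ + 1) T, ∀ x v, ⊥ < F t x v)
    (hconv : ∀ t ∈ Finset.Icc (τ + 1) T, Convex ℝ (epi fun q : E n × E n => F t q.1 q.2))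
    (hh : Convex ℝ (epi h)) {η : E n} {m : ℝ}
    (hm : ∀ y, ((m + inner ℝ η (y τ) : ℝ) : EReal) ≤ cost T F h τ y) :
    ∃ p : ℕ → E n, p τ = -η ∧
      cost T (dualStage F) (dualTerminal h) τ p ≤ ((-m : ℝ) : EReal) := by
  obtain ⟨p, hpτ, hp⟩ := hq.exists_adjoint_arc hbot hconv hh hm
  refine ⟨p, hpτ, cost_dual_le_of_adjoint hτ fun q hq => ?_⟩
  rw [hpτ, inner_neg_right, sub_neg_eq_add, real_inner_comm]
  exact hp q hq

theorem PrimalQualification.exists_cost_le (hq : PrimalQualification T F h)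
    (hbot : ∀ t ∈ Finset.Icc (τ + 1) T, ∀ x v, ⊥ < F t x v)
    (hconv : ∀ t ∈ Finset.Icc (τ + 1) T, Convex ℝ (epi fun q : E n × E n => F t q.1 q.2)) :
    ∃ x, ∃ r : ℝ, cost T F h τ x ≤ r := by
  obtain ⟨x, hx⟩ := hq.exists_mem_relCore hbot hconv
  obtain ⟨⟨_, r⟩, hr, rfl⟩ := hx.1
  exact ⟨x, r, cost_le_of_mem_decoupledEpi hr fun _ _ => rfl⟩

end StrongDuality

section Characteristics

variable {n T τ : ℕ} {L : ℕ → E n → E n → EReal} {g : E n → EReal}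

theorem value_le_cost (x : ℕ → E n) : value T L g τ (x τ) ≤ cost T L g τ x :=
  iInf₂_le (f := fun y (_ : y τ = x τ) => cost T L g τ y) x rfl

theorem FullyConvex.bot_lt_dualStage (hA : FullyConvex T L g) {t : ℕ}
    (ht : t ∈ Finset.Icc (τ + 1) T) (p w : E n) : ⊥ < dualStage L t p w := by
  rw [dualStage_eq_fenchelConj]
  exact bot_lt_fenchelConj (hA.lagrangian_of_mem ht).proper.1 _

theorem FullyConvex.bot_lt_dualTerminal (hA : FullyConvex T L g) (b : E n) :
    ⊥ < dualTerminal g b :=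
  bot_lt_conj hA.terminal.proper.1 _

theorem FullyConvex.cost_dual_dual (hA : FullyConvex T L g) (x : ℕ → E n) :
    cost T (dualStage (dualStage L)) (dualTerminal (dualTerminal g)) τ x = cost T L g τ x := by
  rw [cost, cost, dualTerminal_dualTerminal hA.terminal]
  exact congrArg (· + _) (Finset.sum_congr rfl fun t ht =>
    dualStage_dualStage (hA.lagrangian_of_mem ht) _ _)

theorem FullyConvex.neg_inner_sub_le_value (hA : FullyConvex T L g) (hτ : τ ≤ T) {p : ℕ → E n}
    {d : ℝ} (hp : cost T (dualStage L) (dualTerminal g) τ p ≤ d) (ξ : E n) :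
    ((-inner ℝ ξ (p τ) - d : ℝ) : EReal) ≤ value T L g τ ξ := by
  refine le_iInf₂ fun x hx => ?_
  rw [← hx, EReal.coe_sub]
  exact EReal.sub_le_of_le_add ((hA.neg_inner_le_cost_add_cost hτ x p).trans (by gcongr))

theorem FullyConvex.mem_subdiff_value_of_hasCharacteristic (hA : FullyConvex T L g) (hτ : τ ≤ T)
    {ξ η : E n} (hchar : HasCharacteristic T L g τ ξ η) : η ∈ subdiff (value T L g τ) ξ := by
  obtain ⟨x, p, htraj, rfl, hpτ, htrans⟩ := hchar
  have hle := (hA.cost_add_cost_le_iff hτ x p).2 ⟨htraj, htrans⟩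
  obtain ⟨c, d, hc, hd⟩ := exists_coe_of_add_lt_top
    (bot_lt_cost (fun t ht x v => (hA.lagrangian_of_mem ht).proper.2 (x, v)) hA.terminal.proper.2 x)
    (bot_lt_cost (fun t ht => hA.bot_lt_dualStage ht) hA.bot_lt_dualTerminal p)
    (hle.trans_lt (EReal.coe_lt_top _))
  have hcd : c + d ≤ -inner ℝ (x τ) (p τ) := by
    rw [hc, hd] at hle
    exact_mod_cast hle
  have hvalue : value T L g τ (x τ) ≤ c := hc ▸ value_le_cost x
  refine ⟨hvalue.trans_lt (EReal.coe_lt_top c), fun z => ?_⟩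
  calc value T L g τ (x τ) + dot η (z - x τ)
      ≤ ((c + inner ℝ η (z - x τ) : ℝ) : EReal) := by
        rw [EReal.coe_add]
        exact add_le_add_left hvalue _
    _ ≤ ((-inner ℝ z (p τ) - d : ℝ) : EReal) := by
        rw [EReal.coe_le_coe_iff]
        simp only [hpτ, inner_neg_right, inner_sub_right, real_inner_comm] at hcd ⊢
        linarith
    _ ≤ value T L g τ z := hA.neg_inner_sub_le_value hτ hd.le z

theorem convex_epi_dualStage (L : ℕ → E n → E n → EReal) (t : ℕ) :
    Convex ℝ (epi fun q : E n × E n => dualStage L t q.1 q.2) := by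
  simp only [dualStage_eq_fenchelConj]
  exact convex_epi_fenchelConj _ _

theorem FullyConvex.exists_primal_optimal_arc (hA : FullyConvex T L g) (hτ : τ ≤ T)
    (hq : DualQualification T L g) {ξ : E n} {m : ℝ} (hm : value T L g τ ξ = m) :
    ∃ x : ℕ → E n, x τ = ξ ∧ cost T L g τ x ≤ m := by
  have hq' : PrimalQualification T (dualStage L) (dualTerminal g) := hq
  have hdual (p : ℕ → E n) : ((-m + inner ℝ (-ξ) (p τ) : ℝ) : EReal) ≤
      cost T (dualStage L) (dualTerminal g) τ p := by
    refine coe_le_iff_forall_le_coe.2 fun d hd => ?_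
    have hle := EReal.coe_le_coe_iff.1 ((hA.neg_inner_sub_le_value hτ hd ξ).trans_eq hm)
    rw [inner_neg_left]
    linarith
  obtain ⟨x, hx, hcost⟩ := hq'.exists_dual_arc hτ (fun t ht => hA.bot_lt_dualStage ht)
    (fun t _ => convex_epi_dualStage L t)
    (dualTerminal_eq_fenchelConj g ▸ convex_epi_fenchelConj _ _) hdual
  rw [hA.cost_dual_dual, neg_neg] at hcost
  exact ⟨x, hx.trans (neg_neg ξ), hcost⟩

theorem FullyConvex.exists_dual_optimal_arc (hA : FullyConvex T L g) (hτ : τ ≤ T)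
    (hq : PrimalQualification T L g) {ξ η : E n} {m : ℝ} (hm : value T L g τ ξ = m)
    (hη : η ∈ subdiff (value T L g τ) ξ) :
    ∃ p : ℕ → E n, p τ = -η ∧
      cost T (dualStage L) (dualTerminal g) τ p ≤ ((inner ℝ η ξ - m : ℝ) : EReal) := by
  have hprimal (y : ℕ → E n) :
      ((m - inner ℝ η ξ + inner ℝ η (y τ) : ℝ) : EReal) ≤ cost T L g τ y := by
    have hle := (hη.2 (y τ)).trans (value_le_cost y)
    rwa [hm, dot, ← EReal.coe_add, inner_sub_right, ← add_sub_assoc, add_sub_right_comm] at hle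
  rw [← neg_sub]
  exact hq.exists_dual_arc hτ (fun t ht x v => (hA.lagrangian_of_mem ht).proper.2 (x, v))
    (fun t ht => (hA.lagrangian_of_mem ht).convex) hA.terminal.convex hprimal

theorem FullyConvex.bot_lt_value (hA : FullyConvex T L g) (hτ : τ ≤ T)
    (hq : DualQualification T L g) (ξ : E n) : ⊥ < value T L g τ ξ := by
  have hq' : PrimalQualification T (dualStage L) (dualTerminal g) := hq
  obtain ⟨p, d, hd⟩ := hq'.exists_cost_le (τ := τ) (fun t ht => hA.bot_lt_dualStage ht)
    fun t _ => convex_epi_dualStage L t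
  exact (EReal.bot_lt_coe _).trans_le (hA.neg_inner_sub_le_value hτ hd ξ)

theorem FullyConvex.hasCharacteristic_of_mem_subdiff_value (hA : FullyConvex T L g) (hτ : τ ≤ T)
    (hprimal : PrimalQualification T L g) (hdual : DualQualification T L g) {ξ η : E n}
    (hη : η ∈ subdiff (value T L g τ) ξ) : HasCharacteristic T L g τ ξ η := by
  obtain ⟨m, hm⟩ := exists_coe_eq (hA.bot_lt_value hτ hdual ξ) hη.1
  obtain ⟨x, hxτ, hx⟩ := hA.exists_primal_optimal_arc hτ hdual hm
  obtain ⟨p, hpτ, hp⟩ := hA.exists_dual_optimal_arc hτ hprimal hm hη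
  have hle : cost T L g τ x + cost T (dualStage L) (dualTerminal g) τ p ≤
      ((-inner ℝ (x τ) (p τ) : ℝ) : EReal) := by
    refine (add_le_add hx hp).trans_eq ?_
    rw [hxτ, hpτ, inner_neg_right, neg_neg, real_inner_comm, ← EReal.coe_add, add_sub_cancel]
  obtain ⟨htraj, htrans⟩ := (hA.cost_add_cost_le_iff hτ x p).1 hle
  exact ⟨x, p, htraj, hxτ, hpτ, htrans⟩

end Characteristics

end Bolza

theorem mainTheorem1 (n T : ℕ) (L : ℕ → Bolza.E n → Bolza.E n → EReal)
    (g : Bolza.E n → EReal) (hA : Bolza.FullyConvex T L g)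
    (τ : ℕ) (hτ : τ < T) (ξ η : Bolza.E n) :
    (Bolza.HasCharacteristic T L g τ ξ η → η ∈ Bolza.subdiff (Bolza.value T L g τ) ξ) ∧
    (Bolza.PrimalQualification T L g → Bolza.DualQualification T L g →
      η ∈ Bolza.subdiff (Bolza.value T L g τ) ξ → Bolza.HasCharacteristic T L g τ ξ η) :=
  ⟨hA.mem_subdiff_value_of_hasCharacteristic hτ.le,
    fun hprimal hdual => hA.hasCharacteristic_of_mem_subdiff_value hτ.le hprimal hdual⟩
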